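/- A finite discrete dynamical system (FDDS) is a finite (possibly empty) set $A$ with a function $f_A : A \to A$; equivalently, a finite functional digraph, with edges $x \to f_A(x)$. Let $\mathbb{D}$ be the commutative semiring of FDDSs up to isomorphism, with disjoint union as sum and direct product, $(x,y) \mapsto (f_A(x), f_B(y))$ on $A \times B$, as product. A dendron is a (weakly) connected FDDS whose cycle has length $1$. Let $P = \sum_{i=0}^{m} A_i X^i$ be a polynomial with coefficients $A_i \in \mathbb{D}$. Then $P$ is injective, i.e. the map $\mathbb{D} \to \mathbb{D}$, $X \mapsto P(X)$, is injective, if and only if at least one coefficient $A_i$ with $i > 0$ contains a dendron, i.e. has a connected component that is a dendron. -/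

import Mathlib

/-- A finite discrete dynamical system: a finite (possibly empty) set of states with a
transition function. -/
structure FDDS where
  State : Type
  [finite : Finite State]
  next : State → State

namespace FDDS

attribute [instance] FDDS.finite

/-- Isomorphism of FDDSs: a bijection of the states that commutes with the transition functions
(equivalently, an isomorphism of the functional digraphs). -/
def Iso (A B : FDDS) : Prop :=
  ∃ e : A.State ≃ B.State, ∀ x, e (A.next x) = B.next (e x)

/-- Sum: mutually exclusive alternative execution (disjoint union of functional digraphs). -/
def sum (A B : FDDS) : FDDS where
  State := A.State ⊕ B.State
  next := Sum.map A.next B.next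

/-- Product: synchronous parallel execution (direct product of functional digraphs). -/
def prod (A B : FDDS) : FDDS where
  State := A.State × B.State
  next := Prod.map A.next B.next

/-- The FDDS without states. -/
def empty : FDDS where
  State := Empty
  next := id

/-- The FDDS that consists of a single fixed point. -/
def point : FDDS where
  State := Unit
  next := id

/-- `A` is (weakly) connected as a functional digraph, with edges `x → A.next x`: it has a state,
and any two states are related by the equivalence relation generated by the edges. -/
def IsConnected (A : FDDS) : Prop :=
  Nonempty A.State ∧ ∀ x y : A.State, Relation.EqvGen (fun u v => A.next u = v) x y

/-- `A` has a limit cycle of length `n`: a periodic state whose least positive period is `n`. -/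
def HasCycleOfLength (A : FDDS) (n : ℕ) : Prop :=
  ∃ x ∈ Function.periodicPts A.next, Function.minimalPeriod A.next x = n

/-- A dendron is a connected FDDS whose (unique) cycle has length `1`. -/
def IsDendron (A : FDDS) : Prop :=
  A.IsConnected ∧ A.HasCycleOfLength 1

theorem Iso.refl (A : FDDS) : Iso A A := ⟨Equiv.refl _, fun _ => rfl⟩

theorem Iso.symm {A B : FDDS} : Iso A B → Iso B A := by
  rintro ⟨e, he⟩
  exact ⟨e.symm, fun x => by rw [Equiv.symm_apply_eq, he, Equiv.apply_symm_apply]⟩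

theorem Iso.trans {A B C : FDDS} : Iso A B → Iso B C → Iso A C := by
  rintro ⟨e, he⟩ ⟨g, hg⟩
  exact ⟨e.trans g, fun x => by simp [he, hg]⟩

instance setoid : Setoid FDDS where
  r := Iso
  iseqv := ⟨Iso.refl, Iso.symm, Iso.trans⟩

theorem Iso.sum {A A' B B' : FDDS} : Iso A A' → Iso B B' → Iso (A.sum B) (A'.sum B') := by
  rintro ⟨e, he⟩ ⟨g, hg⟩
  refine ⟨Equiv.sumCongr e g, ?_⟩
  rintro (x | x)
  · exact congrArg Sum.inl (he x)
  · exact congrArg Sum.inr (hg x)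

theorem Iso.prod {A A' B B' : FDDS} : Iso A A' → Iso B B' → Iso (A.prod B) (A'.prod B') := by
  rintro ⟨e, he⟩ ⟨g, hg⟩
  exact ⟨Equiv.prodCongr e g, fun x => Prod.ext (he x.1) (hg x.2)⟩

end FDDS

/-- The set of FDDSs up to isomorphism. -/
def FDDSClass : Type 1 := Quotient FDDS.setoid

namespace FDDSClass

/-- The isomorphism class of an FDDS. -/
def mk (A : FDDS) : FDDSClass := Quotient.mk FDDS.setoid A

instance : Zero FDDSClass := ⟨mk FDDS.empty⟩

instance : One FDDSClass := ⟨mk FDDS.point⟩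

instance : Add FDDSClass :=
  ⟨Quotient.map₂ FDDS.sum fun _ _ h _ _ h' => FDDS.Iso.sum h h'⟩

instance : Mul FDDSClass :=
  ⟨Quotient.map₂ FDDS.prod fun _ _ h _ _ h' => FDDS.Iso.prod h h'⟩

/-- The commutative semiring of FDDSs up to isomorphism. -/
instance : CommSemiring FDDSClass where
  add_assoc := by
    rintro ⟨A⟩ ⟨B⟩ ⟨C⟩
    refine Quotient.sound ⟨Equiv.sumAssoc _ _ _, ?_⟩
    rintro ((x | x) | x) <;> rfl
  zero_add := by
    rintro ⟨A⟩
    refine Quotient.sound ⟨Equiv.emptySum Empty A.State, ?_⟩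
    rintro (x | x)
    · exact x.elim
    · rfl
  add_zero := by
    rintro ⟨A⟩
    refine Quotient.sound ⟨Equiv.sumEmpty A.State Empty, ?_⟩
    rintro (x | x)
    · rfl
    · exact x.elim
  add_comm := by
    rintro ⟨A⟩ ⟨B⟩
    refine Quotient.sound ⟨Equiv.sumComm _ _, ?_⟩
    rintro (x | x) <;> rfl
  mul_assoc := by
    rintro ⟨A⟩ ⟨B⟩ ⟨C⟩
    exact Quotient.sound ⟨Equiv.prodAssoc _ _ _, fun _ => rfl⟩
  one_mul := by
    rintro ⟨A⟩
    exact Quotient.sound ⟨Equiv.punitProd A.State, fun _ => rfl⟩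
  mul_one := by
    rintro ⟨A⟩
    exact Quotient.sound ⟨Equiv.prodPUnit A.State, fun _ => rfl⟩
  mul_comm := by
    rintro ⟨A⟩ ⟨B⟩
    exact Quotient.sound ⟨Equiv.prodComm _ _, fun _ => rfl⟩
  left_distrib := by
    rintro ⟨A⟩ ⟨B⟩ ⟨C⟩
    refine Quotient.sound ⟨Equiv.prodSumDistrib _ _ _, ?_⟩
    rintro ⟨x, (y | y)⟩ <;> rfl
  right_distrib := by
    rintro ⟨A⟩ ⟨B⟩ ⟨C⟩
    refine Quotient.sound ⟨Equiv.sumProdDistrib _ _ _, ?_⟩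
    rintro ⟨(x | x), y⟩ <;> rfl
  zero_mul := by
    rintro ⟨A⟩
    exact Quotient.sound ⟨(Equiv.equivOfIsEmpty _ _ : Empty × A.State ≃ Empty), fun x => x.1.elim⟩
  mul_zero := by
    rintro ⟨A⟩
    exact Quotient.sound ⟨(Equiv.equivOfIsEmpty _ _ : A.State × Empty ≃ Empty), fun x => x.2.elim⟩
  nsmul := nsmulRec

/-- `A` contains a dendron: one of its connected components is a dendron, that is, `A` is the
disjoint union of a dendron and some (possibly empty) FDDS. -/
def ContainsDendron (A : FDDSClass) : Prop :=
  ∃ D C : FDDS, D.IsDendron ∧ A = mk D + mk C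

end FDDSClass

/-! For connected `C`, the map `X ↦ |Hom(C, X)|` is a semiring homomorphism to ℕ (`homCountHom`),
and by a Lovász-type argument these homomorphisms together separate isomorphism classes
(`iso_of_homCount_eq`). So `P` may be studied through the polynomials `∑ |Hom(C, A_i)| n^i` over ℕ.
Containing a dendron means having a fixed point. If some `A_i` with `i > 0` has one, constant maps
give `|Hom(C, A_i)| > 0` for every `C`, all these polynomials are strictly increasing, and `P` is
injective. Otherwise, a connected `C` with a morphism to some `A_i`, `i > 0`, also maps to a cycle
of length `d` with `2 ≤ d ≤ M`, where `M` bounds the sizes of the `A_i`. Distinct `X`, `Y` that no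
such `C` distinguishes (`exists_ne_homCountHom_eq`) then satisfy `P(X) = P(Y)`: for every other `C`
only the constant term survives. -/

namespace FDDS

/-! ### Morphism counts and their compatibility with sums and products -/

/-- Morphisms of FDDSs: maps of the states that commute with the transition functions. -/
def Hom (C A : FDDS) : Type :=
  {f : C.State → A.State // ∀ x, f (C.next x) = A.next (f x)}

/-- Injective morphisms of FDDSs. -/
def Emb (C A : FDDS) : Type :=
  {f : Hom C A // Function.Injective f.1}

instance (C A : FDDS) : Finite (Hom C A) := Subtype.finite

instance (C A : FDDS) : Finite (Emb C A) := Subtype.finite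

/-- The number of morphisms from `C` to `A`. -/
noncomputable def homCount (C A : FDDS) : ℕ := Nat.card (Hom C A)

theorem homCount_congr_right (C : FDDS) {A B : FDDS} (h : Iso A B) :
    homCount C A = homCount C B := by
  obtain ⟨e, he⟩ := h
  refine Nat.card_congr ((Equiv.arrowCongr (Equiv.refl _) e).subtypeEquiv fun f => ?_)
  simp [← he]

theorem homCount_congr_left {C D : FDDS} (h : Iso C D) (A : FDDS) :
    homCount C A = homCount D A := by
  obtain ⟨e, he⟩ := h
  refine Nat.card_congr ((Equiv.arrowCongr e (Equiv.refl _)).subtypeEquiv fun f => ?_)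
  constructor
  · intro hf x
    obtain ⟨x, rfl⟩ := e.surjective x
    simp [← he, hf]
  · intro hf x
    simpa [← he] using hf (e x)

theorem card_emb_congr_left {C D : FDDS} (h : Iso C D) (A : FDDS) :
    Nat.card (Emb C A) = Nat.card (Emb D A) := by
  obtain ⟨e, he⟩ := h
  have he' : ∀ x, e.symm (D.next x) = C.next (e.symm x) := fun x => by
    rw [Equiv.symm_apply_eq, he, Equiv.apply_symm_apply]
  refine Nat.card_congr
    ⟨fun f => ⟨⟨f.1.1 ∘ e.symm, fun x => by simp [he', f.1.2]⟩, f.2.comp e.symm.injective⟩,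
     fun f => ⟨⟨f.1.1 ∘ e, fun x => by simp [he, f.1.2]⟩, f.2.comp e.injective⟩,
     fun f => ?_, fun f => ?_⟩
  · exact Subtype.ext (Subtype.ext (by ext; simp))
  · exact Subtype.ext (Subtype.ext (by ext; simp))

theorem homCount_prod (C A B : FDDS) :
    homCount C (A.prod B) = homCount C A * homCount C B := by
  rw [homCount, homCount, homCount, ← Nat.card_prod]
  exact Nat.card_congr
    ⟨fun f => (⟨fun x => (f.1 x).1, fun x => congrArg Prod.fst (f.2 x)⟩,
        ⟨fun x => (f.1 x).2, fun x => congrArg Prod.snd (f.2 x)⟩),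
     fun f => ⟨fun x => (f.1.1 x, f.2.1 x), fun x => Prod.ext (f.1.2 x) (f.2.2 x)⟩,
     fun _ => rfl, fun _ => rfl⟩

theorem homCount_sum_left (C D A : FDDS) :
    homCount (C.sum D) A = homCount C A * homCount D A := by
  rw [homCount, homCount, homCount, ← Nat.card_prod]
  refine Nat.card_congr
    ⟨fun f => (⟨fun x => f.1 (Sum.inl x), fun x => f.2 (Sum.inl x)⟩,
        ⟨fun x => f.1 (Sum.inr x), fun x => f.2 (Sum.inr x)⟩),
     fun f => ⟨Sum.elim f.1.1 f.2.1, ?_⟩, fun f => ?_, fun _ => rfl⟩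
  · rintro (x | x)
    · exact f.1.2 x
    · exact f.2.2 x
  · exact Subtype.ext (by ext (x | x) <;> rfl)

theorem homCount_point (C : FDDS) : homCount C point = 1 := by
  rw [homCount, Nat.card_eq_one_iff_unique]
  exact ⟨⟨fun f g => Subtype.ext (funext fun _ => rfl)⟩, ⟨⟨fun _ => (), fun _ => rfl⟩⟩⟩

theorem IsConnected.homCount_empty {C : FDDS} (hC : C.IsConnected) : homCount C empty = 0 := by
  obtain ⟨x⟩ := hC.1
  rw [homCount, Nat.card_eq_zero]
  exact Or.inl ⟨fun f => (f.1 x : Empty).elim⟩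

/-- A property of states that is preserved and reflected by the transition function holds
everywhere on a connected FDDS as soon as it holds somewhere. -/
theorem IsConnected.forall_of_exists {C : FDDS} (hC : C.IsConnected) {p : C.State → Prop}
    (hp : ∀ x, p (C.next x) ↔ p x) {x : C.State} (hx : p x) (y : C.State) : p y := by
  have h : p x ↔ p y := by
    clear hx
    induction hC.2 x y with
    | rel u v h => rw [← h, hp]
    | refl u => rfl
    | symm u v _ ih => exact ih.symm
    | trans u v w _ _ ih ih' => exact ih.trans ih'
  exact h.1 hx

/-- The summand in which a state lands is invariant under the transition function, so a connected
`C` maps entirely into one summand. -/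
theorem IsConnected.homCount_sum {C : FDDS} (hC : C.IsConnected) (A B : FDDS) :
    homCount C (A.sum B) = homCount C A + homCount C B := by
  obtain ⟨x₀⟩ := hC.1
  rw [homCount, homCount, homCount, ← Nat.card_sum]
  symm
  refine Nat.card_eq_of_bijective
    (Sum.elim
      (fun f => (⟨fun x => Sum.inl (f.1 x), fun x => congrArg Sum.inl (f.2 x)⟩ :
        Hom C (A.sum B)))
      (fun f => ⟨fun x => Sum.inr (f.1 x), fun x => congrArg Sum.inr (f.2 x)⟩)) ⟨?_, ?_⟩
  · rintro (f | f) (g | g) h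
    · exact congrArg Sum.inl (Subtype.ext (funext fun x =>
        Sum.inl_injective (congrFun (congrArg Subtype.val h) x)))
    · exact absurd (congrFun (congrArg Subtype.val h) x₀) Sum.inl_ne_inr
    · exact absurd (congrFun (congrArg Subtype.val h) x₀) Sum.inr_ne_inl
    · exact congrArg Sum.inr (Subtype.ext (funext fun x =>
        Sum.inr_injective (congrFun (congrArg Subtype.val h) x)))
  · intro f
    have step : ∀ x, (f.1 (C.next x)).isLeft = (f.1 x).isLeft := fun x => by
      rw [f.2]
      exact Sum.isLeft_map _ _ _
    cases h : (f.1 x₀).isLeft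
    · have hr : ∀ x, ∃ a, f.1 x = Sum.inr a := fun x => by
        have := hC.forall_of_exists (p := fun x => (f.1 x).isLeft = false)
          (fun x => by rw [step]) h x
        exact Sum.isRight_iff.1 (Sum.isLeft_eq_false.1 this)
      choose g hg using hr
      refine ⟨Sum.inr ⟨g, fun x => ?_⟩, Subtype.ext (funext fun x => (hg x).symm)⟩
      have := f.2 x
      rw [hg, hg] at this
      exact Sum.inr_injective this
    · have hr : ∀ x, ∃ a, f.1 x = Sum.inl a := fun x => by
        have := hC.forall_of_exists (p := fun x => (f.1 x).isLeft = true)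
          (fun x => by rw [step]) h x
        exact Sum.isLeft_iff.1 this
      choose g hg using hr
      refine ⟨Sum.inl ⟨g, fun x => ?_⟩, Subtype.ext (funext fun x => (hg x).symm)⟩
      have := f.2 x
      rw [hg, hg] at this
      exact Sum.inl_injective this

/-! ### Connected components -/

/-- The subsystem on an invariant set of states. -/
def restrict (A : FDDS) (s : Set A.State) (hs : ∀ x ∈ s, A.next x ∈ s) : FDDS where
  State := s
  next := fun x => ⟨A.next x, hs x x.2⟩

theorem coe_iterate_restrict_next (A : FDDS) (s : Set A.State) (hs : ∀ x ∈ s, A.next x ∈ s)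
    (n : ℕ)
    (x : (A.restrict s hs).State) : ((A.restrict s hs).next^[n] x).1 = A.next^[n] x.1 := by
  induction n with
  | zero => rfl
  | succ n ih =>
    rw [Function.iterate_succ_apply', Function.iterate_succ_apply', ← ih]
    rfl

theorem eqvGen_iterate (A : FDDS) (x : A.State) (n : ℕ) :
    Relation.EqvGen (fun u v => A.next u = v) x (A.next^[n] x) := by
  induction n with
  | zero => exact .refl _
  | succ n ih =>
    refine .trans _ _ _ ih (.rel _ _ ?_)
    rw [Function.iterate_succ_apply']

/-- The connected component of a state splits off as a summand. -/
theorem exists_component (A : FDDS) (x : A.State) :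
    ∃ D C : FDDS, D.IsConnected ∧ Iso A (D.sum C) ∧
      (A.next x = x → D.HasCycleOfLength 1) := by
  classical
  -- The component of `x` consists of the states whose forward orbit meets that of `x`.
  let s : Set A.State := {y | ∃ m n, A.next^[m] y = A.next^[n] x}
  have hx : x ∈ s := ⟨0, 0, rfl⟩
  have hs : ∀ y ∈ s, A.next y ∈ s := by
    rintro y ⟨m, n, h⟩
    refine ⟨m, n + 1, ?_⟩
    rw [← Function.iterate_succ_apply, Function.iterate_succ_apply', h,
      Function.iterate_succ_apply']
  have hs' : ∀ y ∈ sᶜ, A.next y ∈ sᶜ := by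
    rintro y hy ⟨m, n, h⟩
    exact hy ⟨m + 1, n, h⟩
  refine ⟨A.restrict s hs, A.restrict sᶜ hs', ⟨⟨⟨x, hx⟩⟩, ?_⟩, ?_, ?_⟩
  · rintro ⟨y, m, n, hy⟩ ⟨z, k, l, hz⟩
    have key : (A.restrict s hs).next^[l + m] ⟨y, m, n, hy⟩ =
        (A.restrict s hs).next^[n + k] ⟨z, k, l, hz⟩ := by
      apply Subtype.ext
      refine (coe_iterate_restrict_next A s hs _ _).trans
        (Eq.trans ?_ (coe_iterate_restrict_next A s hs _ _).symm)
      rw [Function.iterate_add_apply, hy, Function.iterate_add_apply, hz,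
        ← Function.iterate_add_apply, ← Function.iterate_add_apply, add_comm]
    have h₁ := eqvGen_iterate (A.restrict s hs) ⟨y, m, n, hy⟩ (l + m)
    rw [key] at h₁
    exact .trans _ _ _ h₁ (.symm _ _ (eqvGen_iterate _ _ _))
  · refine Iso.symm ⟨Equiv.Set.sumCompl s, ?_⟩
    rintro (y | y) <;> rfl
  · intro h
    have hfix : Function.IsFixedPt (A.restrict s hs).next ⟨x, hx⟩ := Subtype.ext h
    exact ⟨⟨x, hx⟩, Function.mk_mem_periodicPts one_pos (hfix.isPeriodicPt 1), Function.minimalPeriod_eq_one_iff_isFixedPt.2 hfix⟩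

/-! ### Morphism counts determine the isomorphism class (Lovász) -/

/-- An FDDS that receives as many morphisms as another one from each connected FDDS receives as
many morphisms from each FDDS. -/
theorem homCount_eq_of_connected {A B : FDDS}
    (h : ∀ C : FDDS, C.IsConnected → homCount C A = homCount C B) (C : FDDS) :
    homCount C A = homCount C B := by
  induction hn : Nat.card C.State using Nat.strong_induction_on generalizing C with
  | _ n ih =>
    subst hn
    rcases isEmpty_or_nonempty C.State with hC | ⟨⟨x⟩⟩
    · have key : ∀ A : FDDS, homCount C A = 1 := fun A => by
        rw [homCount, Nat.card_eq_one_iff_unique]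
        exact ⟨⟨fun f g => Subtype.ext (funext fun x => hC.elim x)⟩,
          ⟨⟨fun x => hC.elim x, fun x => hC.elim x⟩⟩⟩
      rw [key, key]
    · obtain ⟨D, E, hD, hDE, -⟩ := C.exists_component x
      rw [homCount_congr_left hDE, homCount_congr_left hDE, homCount_sum_left,
        homCount_sum_left, h D hD]
      congr 1
      refine ih _ ?_ E rfl
      obtain ⟨e, -⟩ := hDE
      have hcard : Nat.card C.State = Nat.card D.State + Nat.card E.State :=
        (Nat.card_congr e).trans Nat.card_sum
      have := hD.1
      have : 0 < Nat.card D.State := Nat.card_pos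
      omega

/-- Congruences of an FDDS. -/
def Congruence (C : FDDS) : Type :=
  {r : Setoid C.State // ∀ x y, r x y → r (C.next x) (C.next y)}

instance (C : FDDS) : Finite (Congruence C) :=
  Finite.of_injective (fun r : Congruence C => fun x y => r.1 x y) fun _ _ h =>
    Subtype.ext (Setoid.ext fun x y => iff_of_eq (congrFun (congrFun h x) y))

/-- The quotient of an FDDS by a congruence. -/
def quotient (C : FDDS) (r : Congruence C) : FDDS where
  State := Quotient r.1
  next := Quotient.map C.next r.2

/-- The kernel of a morphism. -/
def Hom.ker {C A : FDDS} (f : Hom C A) : Congruence C :=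
  ⟨Setoid.ker f.1, fun x y h => by
    rw [Setoid.ker_def] at h ⊢
    rw [f.2, f.2, h]⟩

/-- A morphism with a given kernel is the same as an embedding of the quotient. -/
def kerEquivEmb {C : FDDS} (A : FDDS) (r : Congruence C) :
    {f : Hom C A // f.ker = r} ≃ Emb (C.quotient r) A where
  toFun f :=
    ⟨⟨Quotient.lift f.1.1 fun x y h => by
        have h' : f.1.ker.1 x y := by rw [f.2]; exact h
        exact h', by rintro ⟨x⟩; exact f.1.2 x⟩, by
      rintro ⟨x⟩ ⟨y⟩ h
      refine Quotient.sound ?_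
      have h' : f.1.ker.1 x y := h
      rwa [f.2] at h'⟩
  invFun p := ⟨⟨fun x => p.1.1 (Quotient.mk _ x), fun x => p.1.2 (Quotient.mk _ x)⟩,
    Subtype.ext (Setoid.ext fun _ _ =>
      ⟨fun h => Quotient.exact (p.2 h), fun h => congrArg p.1.1 (Quotient.sound h)⟩)⟩
  left_inv _ := rfl
  right_inv p := Subtype.ext (Subtype.ext (funext (by rintro ⟨x⟩; rfl)))

/-- Each morphism factors uniquely as the projection onto the quotient by its kernel followed by an
embedding. -/
theorem homCount_eq_sum (C A : FDDS) [Fintype (Congruence C)] :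
    homCount C A = ∑ r : Congruence C, Nat.card (Emb (C.quotient r) A) := by
  rw [homCount, ← Nat.card_congr (Equiv.sigmaFiberEquiv (Hom.ker (C := C) (A := A))),
    Nat.card_sigma]
  exact Finset.sum_congr rfl fun r _ => Nat.card_congr (kerEquivEmb A r)

/-- The equality congruence. -/
def Congruence.bot (C : FDDS) : Congruence C :=
  ⟨⊥, fun _ _ h => congrArg C.next h⟩

theorem iso_quotient_bot (C : FDDS) : Iso (C.quotient (Congruence.bot C)) C := by
  refine ⟨⟨Quotient.lift id fun _ _ h => h, Quotient.mk _, ?_, fun _ => rfl⟩, ?_⟩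
  · rintro ⟨x⟩
    rfl
  · rintro ⟨x⟩
    rfl

theorem card_quotient_lt (C : FDDS) {r : Congruence C} (hr : r ≠ Congruence.bot C) :
    Nat.card (C.quotient r).State < Nat.card C.State := by
  by_contra! h
  have hbij : Function.Bijective (Quotient.mk r.1) :=
    Function.Surjective.bijective_of_nat_card_le Quotient.mk_surjective h
  refine hr (Subtype.ext (Setoid.ext fun x y => ?_))
  exact ⟨fun hxy => hbij.1 (Quotient.sound hxy), fun hxy => hxy ▸ r.1.refl x⟩

/-- In `homCount_eq_sum` the trivial congruence contributes the embeddings of `C` itself; all other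
terms involve strictly smaller quotients and cancel by induction on the size of `C`. -/
theorem card_emb_eq {A B : FDDS} (h : ∀ C : FDDS, homCount C A = homCount C B) (C : FDDS) :
    Nat.card (Emb C A) = Nat.card (Emb C B) := by
  classical
  induction hn : Nat.card C.State using Nat.strong_induction_on generalizing C with
  | _ n ih =>
    subst hn
    have := Fintype.ofFinite (Congruence C)
    have hC := h C
    rw [homCount_eq_sum, homCount_eq_sum,
      ← Finset.add_sum_erase _ _ (Finset.mem_univ (Congruence.bot C)),
      ← Finset.add_sum_erase (a := Congruence.bot C) _ _ (Finset.mem_univ _),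
      Finset.sum_congr rfl fun r hr =>
        ih _ (card_quotient_lt C (Finset.ne_of_mem_erase hr)) _ rfl,
      card_emb_congr_left (iso_quotient_bot C), card_emb_congr_left (iso_quotient_bot C)] at hC
    exact Nat.add_right_cancel hC

/-- An FDDS is determined up to isomorphism by the numbers of morphisms into it from all connected
FDDSs. -/
theorem iso_of_homCount_eq {A B : FDDS}
    (h : ∀ C : FDDS, C.IsConnected → homCount C A = homCount C B) : Iso A B := by
  have hemb := card_emb_eq (homCount_eq_of_connected h)
  have hid : ∀ A : FDDS, 0 < Nat.card (Emb A A) := fun A =>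
    have : Nonempty (Emb A A) := ⟨⟨⟨id, fun _ => rfl⟩, Function.injective_id⟩⟩
    Nat.card_pos
  have hAB := hid A
  rw [hemb] at hAB
  have hBA := hid B
  rw [← hemb] at hBA
  -- Embeddings in both directions between finite systems: comparing cardinalities makes `f`
  -- bijective.
  obtain ⟨⟨f, hf⟩⟩ := (Nat.card_pos_iff.1 hAB).1
  obtain ⟨⟨g, hg⟩⟩ := (Nat.card_pos_iff.1 hBA).1
  have hbij : Function.Bijective f.1 :=
    hf.bijective_of_nat_card_le (Nat.card_le_card_of_injective _ hg)
  exact ⟨Equiv.ofBijective _ hbij, f.2⟩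

/-! ### Morphisms to cycles -/

/-- The cycle with `d` states. -/
def cycle (d : ℕ) [NeZero d] : FDDS where
  State := ZMod d
  finite := inferInstanceAs (Finite (ZMod d))
  next := fun x => x + 1

/-- A morphism from a connected system to a cycle is determined by its value at one state, and
rotating a given morphism realises all `d` values. -/
theorem IsConnected.homCount_cycle {C : FDDS} (hC : C.IsConnected) {d : ℕ} [NeZero d]
    (f : Hom C (cycle d)) : homCount C (cycle d) = d := by
  obtain ⟨x₀⟩ := hC.1
  conv_rhs => rw [← Nat.card_zmod d]
  refine Nat.card_eq_of_bijective (fun g : Hom C (cycle d) => (g.1 x₀ : ZMod d)) ⟨?_, ?_⟩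
  · intro g g' h
    refine Subtype.ext (funext (hC.forall_of_exists (fun x => ?_) h))
    rw [g.2, g'.2]
    exact add_left_inj (1 : ZMod d)
  · intro a
    let g : C.State → ZMod d := f.1
    have hg : ∀ x, g (C.next x) = g x + 1 := f.2
    refine ⟨⟨fun x => g x + (a - g x₀), fun x => ?_⟩, add_sub_cancel _ _⟩
    change g (C.next x) + (a - g x₀) = g x + (a - g x₀) + 1
    rw [hg]
    exact add_right_comm _ _ _

theorem exists_iterate_mem_periodicPts (A : FDDS) (x : A.State) :
    ∃ n, A.next^[n] x ∈ Function.periodicPts A.next := by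
  obtain ⟨m, n, hne, h⟩ := Finite.exists_ne_map_eq_of_infinite fun n => A.next^[n] x
  wlog hmn : m < n generalizing m n
  · exact this n m hne.symm h.symm (by omega)
  refine ⟨m, Function.mk_mem_periodicPts (Nat.sub_pos_of_lt hmn) ?_⟩
  rw [Function.IsPeriodicPt, Function.IsFixedPt, ← Function.iterate_add_apply,
    Nat.sub_add_cancel hmn.le]
  exact h.symm

/-- A connected FDDS that maps to an FDDS without fixed points maps to a nontrivial cycle. -/
theorem IsConnected.exists_hom_cycle {C A : FDDS} (hC : C.IsConnected)
    (hA : ∀ a, A.next a ≠ a) (f : Hom C A) :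
    ∃ d, ∃ _ : NeZero d, 2 ≤ d ∧ d ≤ Nat.card A.State ∧ Nonempty (Hom C (cycle d)) := by
  obtain ⟨x₀⟩ := hC.1
  obtain ⟨k, hk⟩ := A.exists_iterate_mem_periodicPts (f.1 x₀)
  set a := A.next^[k] (f.1 x₀) with ha
  set d := Function.minimalPeriod A.next a with hd
  have hpos : 0 < d := Function.minimalPeriod_pos_of_mem_periodicPts hk
  have hda : A.next^[d] a = a := Function.iterate_minimalPeriod
  -- The image of `C` feeds into the single cycle through `a`. In the second direction a full turn
  -- `d` is added so that the subtraction of `1` is harmless when `n = 0`.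
  have hreach : ∀ y, ∃ n, A.next^[n] (f.1 y) = a := by
    refine hC.forall_of_exists (fun y => ⟨?_, ?_⟩) ⟨k, rfl⟩
    · rintro ⟨n, hn⟩
      refine ⟨n + 1, ?_⟩
      rw [Function.iterate_succ_apply, ← f.2, hn]
    · rintro ⟨n, hn⟩
      refine ⟨n + d - 1, ?_⟩
      rw [f.2, ← Function.iterate_succ_apply, Nat.succ_eq_add_one,
        Nat.sub_add_cancel (by omega), add_comm, Function.iterate_add_apply, hn, hda]
  have huniq : ∀ y m n, m ≤ n → A.next^[m] y = a → A.next^[n] y = a →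
      (m : ZMod d) = n := by
    intro y m n hmn hm hn
    rw [← Nat.sub_add_cancel hmn, Function.iterate_add_apply, hm] at hn
    have hdvd : d ∣ n - m := Function.IsPeriodicPt.minimalPeriod_dvd hn
    have := (ZMod.natCast_eq_zero_iff _ _).2 hdvd
    rw [Nat.cast_sub hmn] at this
    exact (sub_eq_zero.1 this).symm
  have huniq' : ∀ y m n, A.next^[m] y = a → A.next^[n] y = a → (m : ZMod d) = n := by
    intro y m n hm hn
    rcases le_total m n with h | h
    · exact huniq y m n h hm hn
    · exact (huniq y n m h hn hm).symm
  choose t ht using hreach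
  -- The time needed to reach `a` is well defined modulo `d` and drops by one at each transition;
  -- its negative is therefore a morphism to the cycle.
  refine ⟨d, ⟨hpos.ne'⟩, ?_, ?_, ⟨⟨fun y => (-(t y : ZMod d) : ZMod d), fun y => ?_⟩⟩⟩
  · have : d ≠ 1 := fun h => hA a (Function.minimalPeriod_eq_one_iff_isFixedPt.1 h)
    omega
  · have hinj : Function.Injective fun i : Fin d => A.next^[i] a := by
      intro i j hij
      exact Fin.ext (Function.iterate_injOn_Iio_minimalPeriod i.2 j.2 hij)
    simpa using Nat.card_le_card_of_injective _ hinj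
  · have h : (t y : ZMod d) = (t (C.next y) + 1 : ℕ) := by
      refine huniq' (f.1 y) _ _ (ht y) ?_
      rw [Function.iterate_succ_apply, ← f.2, ht]
    change (-(t (C.next y) : ZMod d) : ZMod d) = -(t y : ZMod d) + 1
    rw [h]
    push_cast
    ring

end FDDS

/-! ### Semiring homomorphisms to ℕ, and dendrons as fixed points -/

namespace FDDSClass

open FDDS

/-- Counting the morphisms from a connected FDDS is a homomorphism of semirings. -/
noncomputable def homCountHom (C : FDDS) (hC : C.IsConnected) : FDDSClass →+* ℕ where
  toFun := Quotient.lift (homCount C) fun _ _ h => homCount_congr_right C h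
  map_zero' := hC.homCount_empty
  map_one' := homCount_point C
  map_add' := by
    rintro ⟨A⟩ ⟨B⟩
    exact hC.homCount_sum A B
  map_mul' := by
    rintro ⟨A⟩ ⟨B⟩
    exact homCount_prod C A B

theorem eq_of_homCountHom_eq {X Y : FDDSClass}
    (h : ∀ (C : FDDS) (hC : C.IsConnected), homCountHom C hC X = homCountHom C hC Y) :
    X = Y := by
  obtain ⟨A⟩ := X
  obtain ⟨B⟩ := Y
  exact Quotient.sound (iso_of_homCount_eq h)

theorem homCountHom_eval (C : FDDS) (hC : C.IsConnected) (P : Polynomial FDDSClass)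
    (X : FDDSClass) :
    homCountHom C hC (P.eval X) = ∑ i ∈ Finset.range (P.natDegree + 1),
      homCountHom C hC (P.coeff i) * homCountHom C hC X ^ i := by
  simp [Polynomial.eval_eq_sum_range]

/-- A state of minimal period `1` is a fixed point, and conversely the component of a fixed point
splits off as a dendron. -/
theorem containsDendron_mk_iff (A : FDDS) :
    (mk A).ContainsDendron ↔ ∃ a, A.next a = a := by
  constructor
  · rintro ⟨D, C, ⟨-, x, -, hx⟩, h⟩
    obtain ⟨e, he⟩ := Iso.symm (Quotient.exact h)
    refine ⟨e (Sum.inl x), ?_⟩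
    refine (he (Sum.inl x)).symm.trans ?_
    exact congrArg (fun y => e (Sum.inl y)) (Function.minimalPeriod_eq_one_iff_isFixedPt.1 hx)
  · rintro ⟨a, ha⟩
    obtain ⟨D, C, hD, hiso, hcyc⟩ := A.exists_component a
    exact ⟨D, C, ⟨hD, hcyc ha⟩, Quotient.sound hiso⟩

theorem homCountHom_pos_of_containsDendron (C : FDDS) (hC : C.IsConnected) {A : FDDSClass}
    (hA : A.ContainsDendron) : 0 < homCountHom C hC A := by
  obtain ⟨A⟩ := A
  obtain ⟨a, ha⟩ := (containsDendron_mk_iff A).1 hA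
  have : Nonempty (Hom C A) := ⟨⟨fun _ => a, fun _ => ha.symm⟩⟩
  exact Nat.card_pos (α := Hom C A)

theorem containsDendron_one : (1 : FDDSClass).ContainsDendron :=
  (containsDendron_mk_iff point).2 ⟨(), rfl⟩

theorem not_containsDendron_zero : ¬ (0 : FDDSClass).ContainsDendron := fun h =>
  let ⟨a, _⟩ := (containsDendron_mk_iff empty).1 h
  (a : Empty).elim

theorem containsDendron_add (A B : FDDSClass) :
    (A + B).ContainsDendron ↔ A.ContainsDendron ∨ B.ContainsDendron := by
  obtain ⟨A⟩ := A
  obtain ⟨B⟩ := B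
  refine (containsDendron_mk_iff (A.sum B)).trans
    (Iff.trans ?_ (or_congr (containsDendron_mk_iff A) (containsDendron_mk_iff B)).symm)
  constructor
  · rintro ⟨a | b, h⟩
    · exact Or.inl ⟨a, Sum.inl_injective h⟩
    · exact Or.inr ⟨b, Sum.inr_injective h⟩
  · rintro (⟨a, h⟩ | ⟨b, h⟩)
    · exact ⟨Sum.inl a, congrArg Sum.inl h⟩
    · exact ⟨Sum.inr b, congrArg Sum.inr h⟩

theorem containsDendron_mul (A B : FDDSClass) :
    (A * B).ContainsDendron ↔ A.ContainsDendron ∧ B.ContainsDendron := by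
  obtain ⟨A⟩ := A
  obtain ⟨B⟩ := B
  refine (containsDendron_mk_iff (A.prod B)).trans
    (Iff.trans ?_ (and_congr (containsDendron_mk_iff A) (containsDendron_mk_iff B)).symm)
  constructor
  · rintro ⟨⟨a, b⟩, h⟩
    exact ⟨⟨a, congrArg Prod.fst h⟩, ⟨b, congrArg Prod.snd h⟩⟩
  · rintro ⟨⟨a, ha⟩, ⟨b, hb⟩⟩
    exact ⟨⟨a, b⟩, Prod.ext ha hb⟩

theorem containsDendron_natCast_succ (n : ℕ) : ((n + 1 : ℕ) : FDDSClass).ContainsDendron := by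
  rw [Nat.cast_succ, containsDendron_add]
  exact Or.inr containsDendron_one

theorem not_containsDendron_cycle {d : ℕ} [NeZero d] (hd : 2 ≤ d) :
    ¬ (mk (cycle d)).ContainsDendron := by
  rw [containsDendron_mk_iff]
  rintro ⟨a, ha⟩
  have : Fact (1 < d) := ⟨hd⟩
  exact one_ne_zero (α := ZMod d) (left_eq_add.1 (Eq.symm ha))

/-! ### Pairs that witness non-injectivity -/

/-- There are two distinct classes that are not distinguished by the morphisms from any connected
FDDS that maps to a nontrivial cycle of length at most `M`. -/
theorem exists_ne_homCountHom_eq (M : ℕ) : ∃ X Y : FDDSClass,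
    X.ContainsDendron ∧ ¬ Y.ContainsDendron ∧
    ∀ (C : FDDS) (hC : C.IsConnected) (d : ℕ) [NeZero d], 2 ≤ d → d ≤ M →
      Nonempty (Hom C (cycle d)) → homCountHom C hC X = homCountHom C hC Y := by
  induction M with
  | zero => exact ⟨1, 0, containsDendron_one, not_containsDendron_zero, by intros; omega⟩
  | succ M ih =>
    obtain ⟨X, Y, hX, hY, h⟩ := ih
    rcases Nat.eq_zero_or_pos M with rfl | hM
    -- The bound `1` still allows no `d ≥ 2`; it is treated apart because the cycle of length `1`
    -- has a fixed point, which would spoil `Y`.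
    · exact ⟨X, Y, hX, hY, by intros; omega⟩
    -- A connected `C` that maps to the cycle of length `M + 1` counts it as `M + 1`, so it sees
    -- equal sums. If `C` already failed to separate `X` and `Y`, the two sums agree by symmetry. A
    -- fixed point persists in the first sum only.
    refine ⟨X * (M + 1 : ℕ) + Y * mk (cycle (M + 1)), X * mk (cycle (M + 1)) + Y * (M + 1 : ℕ),
      ?_, ?_, ?_⟩
    · rw [containsDendron_add, containsDendron_mul]
      exact Or.inl ⟨hX, containsDendron_natCast_succ M⟩
    · rw [containsDendron_add, containsDendron_mul, containsDendron_mul]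
      rintro (⟨-, h'⟩ | ⟨h', -⟩)
      · exact not_containsDendron_cycle (by omega) h'
      · exact hY h'
    · intro C hC d _ hd hdM hne
      rw [map_add, map_add, map_mul, map_mul, map_mul, map_mul, map_natCast]
      rcases hdM.lt_or_eq with hlt | rfl
      · rw [h C hC d hd (by omega) hne, add_comm]
      · obtain ⟨f⟩ := hne
        have : homCountHom C hC (mk (cycle (M + 1))) = M + 1 := hC.homCount_cycle f
        rw [this, Nat.cast_id]

/-- The largest number of states among the members of `s` bounds every cycle length that can arise,
so one pair serves all `C` and all `A ∈ s`. -/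
theorem exists_homCountHom_eq_zero_or_eq (s : Finset FDDSClass)
    (hs : ∀ A ∈ s, ¬ A.ContainsDendron) : ∃ X Y : FDDSClass, X ≠ Y ∧
    ∀ (C : FDDS) (hC : C.IsConnected), ∀ A ∈ s,
      homCountHom C hC A = 0 ∨ homCountHom C hC X = homCountHom C hC Y := by
  obtain ⟨X, Y, hX, hY, h⟩ :=
    exists_ne_homCountHom_eq (s.sup fun A => Nat.card (Quotient.out A).State)
  refine ⟨X, Y, fun hXY => hY (hXY ▸ hX), fun C hC A hA => or_iff_not_imp_left.2 fun hne => ?_⟩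
  have hle := Finset.le_sup (f := fun A : FDDSClass => Nat.card (Quotient.out A).State) hA
  have hnd := hs A hA
  rw [← Quotient.out_eq A] at hne hnd
  obtain ⟨f⟩ := (Nat.card_pos_iff.1 (Nat.pos_of_ne_zero hne)).1
  obtain ⟨d, _, hd, hdle, hcyc⟩ := hC.exists_hom_cycle
    (fun a ha => hnd ((containsDendron_mk_iff _).2 ⟨a, ha⟩)) f
  exact h C hC d hd (hdle.trans hle) hcyc

end FDDSClass

/-! ### The characterisation of injective polynomials -/

open FDDSClass

theorem mainTheorem1 (P : Polynomial FDDSClass) :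
    Function.Injective (fun X : FDDSClass => P.eval X) ↔
      ∃ i : ℕ, 0 < i ∧ (P.coeff i).ContainsDendron := by
  classical
  constructor
  · intro hinj
    by_contra! hP
    obtain ⟨X, Y, hne, h⟩ := exists_homCountHom_eq_zero_or_eq
      ((Finset.Ioc 0 P.natDegree).image P.coeff) (by
        intro A hA
        obtain ⟨i, hi, rfl⟩ := Finset.mem_image.1 hA
        exact hP i (Finset.mem_Ioc.1 hi).1)
    refine hne (hinj (eq_of_homCountHom_eq fun C hC => ?_))
    rw [homCountHom_eval, homCountHom_eval]
    refine Finset.sum_congr rfl fun i hi => ?_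
    rcases Nat.eq_zero_or_pos i with rfl | hpos
    -- The constant term does not depend on the argument, so nothing is required of `P.coeff 0`.
    · simp
    · have hi' : i ≤ P.natDegree := Nat.lt_succ_iff.1 (Finset.mem_range.1 hi)
      rcases h C hC _ (Finset.mem_image_of_mem _ (Finset.mem_Ioc.2 ⟨hpos, hi'⟩)) with h | h
      · rw [h, zero_mul, zero_mul]
      · rw [h]
  · rintro ⟨i, hpos, hi⟩ X Y hXY
    refine eq_of_homCountHom_eq fun C hC => ?_
    have hcoeff := homCountHom_pos_of_containsDendron C hC hi
    have hmem : i ∈ Finset.range (P.natDegree + 1) := by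
      refine Finset.mem_range.2 (Nat.lt_succ_iff.2 (Polynomial.le_natDegree_of_ne_zero ?_))
      intro h0
      rw [h0, map_zero] at hcoeff
      exact hcoeff.false
    -- All terms are monotone over ℕ, and the `i`-th is strictly so because its coefficient and its
    -- exponent are positive.
    have hmono : StrictMono fun n : ℕ => ∑ j ∈ Finset.range (P.natDegree + 1),
        homCountHom C hC (P.coeff j) * n ^ j := by
      intro m n hmn
      refine Finset.sum_lt_sum (fun j _ => ?_) ⟨i, hmem, ?_⟩
      · exact Nat.mul_le_mul_left _ (Nat.pow_le_pow_left hmn.le j)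
      · exact Nat.mul_lt_mul_of_pos_left (Nat.pow_lt_pow_left hmn hpos.ne') hcoeff
    refine hmono.injective ?_
    have := congrArg (homCountHom C hC) hXY
    simpa only [homCountHom_eval] using this
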